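/- \textbf{Model.} Let $K\ge 0$ be an integer and $X=\{0,1,\dots,K\}$. A \emph{network} is a triple $(n,G,\mathcal L)$, where $n\ge 1$, $G$ is a connected bidirectional graph (without self-loops) on the nodes $1,\dots,n$, and the port labeling $\mathcal L$ assigns to the outgoing edges of each node $i$ distinct labels in $\{0,1,\dots,d(i)\}$, where $d(i)$ is the degree of $i$ (the labels of $(i,j)$ and $(j,i)$ need not be related). The neighbors of $i$ are enumerated as $j_1,\dots,j_{d(i)}$ in increasing order of their labels; $j_k$ is the neighbor at port $k$ of $i$. An \emph{algorithm} with input set $X$ and finite output set $Y$ consists of a finite message set $M$, finite internal memory sets $Z_d$ ($d=0,1,2,\dots$), and for each $d$ a transition map $A_d$, which sends $[x,z,y;(m_1,\dots,m_d)]$ with $x\in X$, $z\in Z_d$, $y\in Y\cup\{\emptyset\}$, $m_k\in M$ to some $[x,z',y';(m_1',\dots,m_d')]$ with the same $x$. The sets $M$ and $Z_d$ contain a special initial element, also denoted $\emptyset$. Given a network and initial values $x_1,\dots,x_n\in X$, every node $i$ starts with $z_i(0)=y_i(0)=m_{i,1}(0)=\dots=m_{i,d(i)}(0)=\emptyset$,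 and for $t=0,1,2,\dots$ $$[x_i,z_i(t+1),y_i(t+1);m_{i,1}(t+1),\dots,m_{i,d(i)}(t+1)]=A_{d(i)}[x_i,z_i(t),y_i(t);m_{j_1,p_1}(t),\dots,m_{j_{d(i)},p_{d(i)}}(t)],$$ where $p_k$ is the port of $j_k$ that leads to $i$. The algorithm \emph{terminates with final output} $y^*$ if there is a time $t'$ such that $y_i(t)=y^*$ for every node $i$ and every $t\ge t'$. A family of functions $f_n:X^n\to Y$, $n=1,2,\dots$, is \emph{computable} if there is one algorithm (not depending on $n$, the network or the initial values) that, for every $n$, every network $(n,G,\mathcal L)$ and all $x_1,\dots,x_n\in X$, terminates with final output $f_n(x_1,\dots,x_n)$. \textbf{Theorem.} For every integer $K\ge 0$, let $$Y=\{\{0\},(0,1),\{1\},(1,2),\dots,\{K-1\},(K-1,K),\{K\}\},$$ and let $f_n:X^n\to Y$ map $(x_1,\dots,x_n)$ to the unique element of $Y$ that contains the average $\frac1n\sum_{i=1}^n x_i$. Then the interval-averaging family $(f_n)_{n=1,2,\dots}$ is computable. That is, every node eventually outputs, forever, the singleton of the exact average if the average is an integer, and otherwise the open interval between consecutive integers that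 contains it. -/

import Mathlib

/-! ### Networks -/

/-- A network on `n` nodes: a connected bidirectional graph with a port labeling. The labeling
gives the outgoing edges of a node `i` distinct labels in `{0, 1, …, d(i)}`, where `d(i)` is the
degree of `i`; the labels of `(i, j)` and `(j, i)` are unrelated. -/
structure Network (n : ℕ) where
  G : SimpleGraph (Fin n)
  connected : G.Connected
  label : ∀ i : Fin n, G.neighborSet i ↪ Fin ((G.neighborSet i).ncard + 1)

namespace Network

variable {n : ℕ} (N : Network n)

/-- The degree `d(i)` of node `i`. -/
noncomputable def deg (i : Fin n) : ℕ := (N.G.neighborSet i).ncard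

/-- The position (counted from `0`) of the neighbor `j` of `i` when the neighbors of `i` are
enumerated in increasing order of their port labels. -/
noncomputable def rank (i : Fin n) (j : N.G.neighborSet i) : ℕ :=
  {j' : N.G.neighborSet i | N.label i j' < N.label i j}.ncard

theorem rank_lt (i : Fin n) (j : N.G.neighborSet i) : N.rank i j < N.deg i := by
  have h : {j' : N.G.neighborSet i | N.label i j' < N.label i j} ⊂ Set.univ :=
    Set.ssubset_univ_iff.2 fun h => lt_irrefl (N.label i j) (h ▸ Set.mem_univ j :)
  have h2 := Set.ncard_lt_ncard h
  rwa [Set.ncard_univ] at h2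

theorem rank_strictMono (i : Fin n) {j k : N.G.neighborSet i} (h : N.label i j < N.label i k) :
    N.rank i j < N.rank i k := by
  refine Set.ncard_lt_ncard ⟨fun a ha => lt_trans ha h, fun hs => ?_⟩
  exact lt_irrefl (N.label i j) (hs (show j ∈ {j' | N.label i j' < N.label i k} from h))

theorem rank_bijective (i : Fin n) :
    Function.Bijective fun j : N.G.neighborSet i => (⟨N.rank i j, N.rank_lt i j⟩ : Fin (N.deg i)) := by
  refine (Nat.bijective_iff_injective_and_card _).2 ⟨fun j k h => ?_, ?_⟩
  · have h' : N.rank i j = N.rank i k := congrArg Fin.val h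
    by_contra hne
    rcases lt_or_gt_of_ne (fun e => hne ((N.label i).injective e)) with hl | hl
    · exact (N.rank_strictMono i hl).ne h'
    · exact (N.rank_strictMono i hl).ne' h'
  · rw [Nat.card_fin]; rfl

/-- The enumeration of the neighbors of `i` by port number: `port i j` is the port of `i` leading
to `j`, and `(port i).symm k` is the node at the other end of the `k`-th outgoing edge of `i`. -/
noncomputable def port (i : Fin n) : N.G.neighborSet i ≃ Fin (N.deg i) :=
  Equiv.ofBijective _ (N.rank_bijective i)

end Network

/-! ### Algorithms -/

/-- An algorithm with input set `{0, …, K}` and output set `Y`: a family of finite automata, one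
for each degree `d`. The special initial elements are `m₀` (messages), `z₀ d` (internal memory) and
`none` (output). The transition `trans d x z y m` gets the initial value, memory state, output and
the `d` incoming messages, and returns the new memory state, output and `d` outgoing messages; the
initial value never changes. -/
structure Algorithm (K : ℕ) (Y : Type) [Finite Y] where
  M : Type
  finite_M : Finite M
  m₀ : M
  Z : ℕ → Type
  finite_Z : ∀ d, Finite (Z d)
  z₀ : ∀ d, Z d
  trans : ∀ d, Fin (K + 1) → Z d → Option Y → (Fin d → M) → Z d × Option Y × (Fin d → M)

namespace Algorithm

variable {K : ℕ} {Y : Type} [Finite Y] (A : Algorithm K Y) {n : ℕ}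

/-- The part of the state of a node of degree `d` that can change: internal memory state, output,
outgoing messages. -/
abbrev State (d : ℕ) : Type := A.Z d × Option Y × (Fin d → A.M)

/-- One time step: node `i` reads, for each port `k`, the message that its `k`-th neighbor `j` has put
into the port of `j` leading to `i`. -/
noncomputable def step (N : Network n) (x : Fin n → Fin (K + 1))
    (s : ∀ i : Fin n, A.State (N.deg i)) (i : Fin n) : A.State (N.deg i) :=
  A.trans (N.deg i) (x i) (s i).1 (s i).2.1 fun k =>
    let j := (N.port i).symm k
    (s j).2.2 (N.port j ⟨i, j.2.symm⟩)

/-- The states of all nodes at time `t`. -/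
noncomputable def state (N : Network n) (x : Fin n → Fin (K + 1)) :
    ℕ → ∀ i : Fin n, A.State (N.deg i)
  | 0 => fun i => (A.z₀ (N.deg i), none, fun _ => A.m₀)
  | t + 1 => A.step N x (state N x t)

/-- The output `y_i(t)` of node `i` at time `t`. -/
noncomputable def output (N : Network n) (x : Fin n → Fin (K + 1)) (t : ℕ) (i : Fin n) : Option Y :=
  (A.state N x t i).2.1

/-- The algorithm terminates with final output `y`. -/
def TerminatesWith (N : Network n) (x : Fin n → Fin (K + 1)) (y : Option Y) : Prop :=
  ∃ t' : ℕ, ∀ i : Fin n, ∀ t ≥ t', A.output N x t i = y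

end Algorithm

/-- A family `f n : X ^ n → Y` is computable if a single algorithm, on every network and for all
initial values, terminates with the value of the family as final output. -/
def NetworkComputable {K : ℕ} {Y : Type} [Finite Y] (f : ∀ n : ℕ, (Fin n → Fin (K + 1)) → Y) : Prop :=
  ∃ A : Algorithm K Y, ∀ (n : ℕ) (N : Network n) (x : Fin n → Fin (K + 1)),
    A.TerminatesWith N x (some (f n x))

/-! ### Interval-averaging -/

/-- The collection `{0}, (0,1), {1}, (1,2), …, {K-1}, (K-1,K), {K}` of subsets of `ℝ`. -/
def intervals (K : ℕ) : Set (Set ℝ) :=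
  {s | (∃ k : ℕ, k ≤ K ∧ s = {(k : ℝ)}) ∨ ∃ k : ℕ, k < K ∧ s = Set.Ioo (k : ℝ) (k + 1)}

instance intervals_finite (K : ℕ) : Finite (intervals K) := by
  have h : intervals K ⊆ (fun k : ℕ => ({(k : ℝ)} : Set ℝ)) '' Set.Iic K ∪
      (fun k : ℕ => Set.Ioo (k : ℝ) (k + 1)) '' Set.Iio K := by
    rintro s (⟨k, hk, rfl⟩ | ⟨k, hk, rfl⟩)
    · exact Or.inl ⟨k, hk, rfl⟩
    · exact Or.inr ⟨k, hk, rfl⟩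
  exact ((((Set.finite_Iic K).image _).union ((Set.finite_Iio K).image _)).subset h).to_subtype

/-- The average `(x_1 + ⋯ + x_n) / n`. -/
noncomputable def average {K n : ℕ} (x : Fin n → Fin (K + 1)) : ℝ :=
  (∑ i, ((x i : ℕ) : ℝ)) / n

theorem existsUnique_interval {K n : ℕ} (x : Fin n → Fin (K + 1)) :
    ∃! s : intervals K, average x ∈ (s : Set ℝ) := by
  have h0 : 0 ≤ average x := by unfold average; positivity
  have h1 : average x ≤ K := by
    unfold average
    refine div_le_of_le_mul₀ (by positivity) (by positivity) ?_
    calc (∑ i, ((x i : ℕ) : ℝ)) ≤ ∑ _i : Fin n, (K : ℝ) :=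
          Finset.sum_le_sum fun i _ => by exact_mod_cast Nat.lt_succ_iff.1 (x i).2
      _ = K * n := by simp [mul_comm]
  generalize average x = a at h0 h1
  have key : ∀ (k m : ℕ), a = k → ¬ ((m : ℝ) < a ∧ a < m + 1) := by
    rintro k m rfl ⟨h, h'⟩
    have h2 : m < k := by exact_mod_cast h
    have h3 : k < m + 1 := by exact_mod_cast h'
    omega
  refine existsUnique_of_exists_of_unique ?_ ?_
  · rcases (Nat.floor_le h0).eq_or_lt with h | h
    · exact ⟨⟨{((⌊a⌋₊ : ℕ) : ℝ)}, Or.inl ⟨_, by exact_mod_cast h.le.trans h1, rfl⟩⟩, h.symm⟩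
    · exact ⟨⟨Set.Ioo ((⌊a⌋₊ : ℕ) : ℝ) (⌊a⌋₊ + 1), Or.inr ⟨_, by exact_mod_cast h.trans_le h1, rfl⟩⟩,
        h, Nat.lt_floor_add_one a⟩
  · rintro ⟨s, ⟨k, hk, rfl⟩ | ⟨k, hk, rfl⟩⟩ ⟨s', ⟨m, hm, rfl⟩ | ⟨m, hm, rfl⟩⟩ h h'
    · have e : a = k := h
      have e' : a = m := h'
      exact Subtype.ext (by simp only; rw [← e, ← e'])
    · exact absurd h' (key k m h)
    · exact absurd h (key m k h')
    · obtain ⟨p, q⟩ : (k : ℝ) < a ∧ a < k + 1 := h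
      obtain ⟨p', q'⟩ : (m : ℝ) < a ∧ a < m + 1 := h'
      have e1 : k < m + 1 := by exact_mod_cast p.trans q'
      have e2 : m < k + 1 := by exact_mod_cast p'.trans q
      obtain rfl : k = m := by omega
      rfl

/-- The interval-averaging family: `intervalAverage K n x` is the element of `intervals K` that
contains the average of `x`. -/
noncomputable def intervalAverage (K n : ℕ) (x : Fin n → Fin (K + 1)) : intervals K :=
  (existsUnique_interval x).choose

/-! Comparing the average with each of 0, …, K locates its interval, and each comparison is a sign
test for a sum of integer weights; these finitely many tests run in parallel
(`intervalAverage_computable_of_sign`). To test whether `∑ i, w (x i)` is positive, units of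
positive load wander as tokens under a rotor rule, while negative loads stay put and absorb them.
Negative parts only shrink, hence stabilize; from then on a node that receives a token becomes
positive. By connectivity, either every node is positive infinitely often or the tokens die out,
according to the sign of the total (`SimpleGraph.Connected.diffusion_limit`). A positive total thus
shows itself at every node, but silence is not observable in finite time. Flags replace it: they
settle, with one raised exactly if the total is not positive (`LoadRun.flag_limit`). A second
diffusion, fed by the flags, then has positive total exactly when the first does not. Changes of
flags before they settle do no harm, because the total load always equals the current total input
(`LoadRun.sum_load`). Memory stays finite by `LoadState.netInflow_mem`. -/

open Filter

/-! ### Combining finitely many computable families -/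

theorem Algorithm.terminatesWith_iff_eventually {K : ℕ} {Y : Type} [Finite Y] (A : Algorithm K Y)
    {n : ℕ} (N : Network n) (x : Fin n → Fin (K + 1)) (y : Option Y) :
    A.TerminatesWith N x y ↔ ∀ᶠ t in atTop, ∀ i, A.output N x t i = y := by
  rw [eventually_atTop]
  exact exists_congr fun _ => ⟨fun h t ht i => h i t ht, fun h i t ht => h t ht i⟩

/-- Apply `g` to a family of outputs once all of them are available. -/
noncomputable def combineOutputs {ι Y Y' : Type} (g : (ι → Y) → Y') (y : ι → Option Y) :
    Option Y' :=
  open Classical in if h : ∀ s, (y s).isSome then some (g fun s => (y s).get (h s)) else none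

theorem combineOutputs_some {ι Y Y' : Type} (g : (ι → Y) → Y') (b : ι → Y) :
    combineOutputs g (fun s => some (b s)) = some (g b) := by
  simp [combineOutputs]

/-- Run a finite family of algorithms in parallel and apply `g` to the outputs. -/
noncomputable def Algorithm.parallel {K : ℕ} {ι Y Y' : Type} [Finite ι] [Finite Y] [Finite Y']
    (A : ι → Algorithm K Y) (g : (ι → Y) → Y') : Algorithm K Y' where
  M := ∀ s, (A s).M
  finite_M := by
    have := fun s => (A s).finite_M
    infer_instance
  m₀ := fun s => (A s).m₀
  Z := fun d => ∀ s, (A s).Z d × Option Y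
  finite_Z := fun d => by
    have := fun s => (A s).finite_Z d
    infer_instance
  z₀ := fun d s => ((A s).z₀ d, none)
  trans := fun d x z _ m =>
    let q := fun s => (A s).trans d x (z s).1 (z s).2 fun k => m k s
    (fun s => ((q s).1, (q s).2.1), combineOutputs g fun s => (q s).2.1, fun k s => (q s).2.2 k)

namespace Algorithm

variable {K : ℕ} {ι Y Y' : Type} [Finite ι] [Finite Y] [Finite Y'] (A : ι → Algorithm K Y)
  (g : (ι → Y) → Y') {n : ℕ} (N : Network n) (x : Fin n → Fin (K + 1))

theorem parallel_state (t : ℕ) (i : Fin n) :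
    ((parallel A g).state N x t i).1 =
        (fun s => (((A s).state N x t i).1, ((A s).state N x t i).2.1)) ∧
      ((parallel A g).state N x t i).2.2 = fun k s => ((A s).state N x t i).2.2 k := by
  induction t generalizing i with
  | zero => exact ⟨rfl, rfl⟩
  | succ t ih =>
    have key : ∀ s, (A s).trans (N.deg i) (x i) (((parallel A g).state N x t i).1 s).1
        (((parallel A g).state N x t i).1 s).2
        (fun k => ((parallel A g).state N x t ((N.port i).symm k)).2.2
          (N.port ((N.port i).symm k) ⟨i, ((N.port i).symm k).2.symm⟩) s) =
        (A s).state N x (t + 1) i := fun s => by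
      simp only [(ih i).1, (ih _).2]
      rfl
    exact ⟨funext fun s => Prod.ext (congrArg (fun q => q.1) (key s))
      (congrArg (fun q => q.2.1) (key s)),
      funext fun k => funext fun s => congrArg (fun q => q.2.2 k) (key s)⟩

/-- Time 0 is excluded: the output is `none` there, whereas for empty `ι` the combination is already
`some`. -/
theorem parallel_output_succ (t : ℕ) (i : Fin n) :
    (parallel A g).output N x (t + 1) i = combineOutputs g fun s => (A s).output N x (t + 1) i := by
  have h := (parallel_state A g N x (t + 1) i).1
  have h2 : (parallel A g).output N x (t + 1) i =
      combineOutputs g fun s => (((parallel A g).state N x (t + 1) i).1 s).2 := rfl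
  rw [h2, h]
  rfl

end Algorithm

theorem NetworkComputable.comp_pi {K : ℕ} {ι Y Y' : Type} [Finite ι] [Finite Y] [Finite Y']
    {f : ι → ∀ n : ℕ, (Fin n → Fin (K + 1)) → Y} (hf : ∀ s, NetworkComputable (f s))
    (g : (ι → Y) → Y') : NetworkComputable fun n x => g fun s => f s n x := by
  choose A hA using hf
  refine ⟨Algorithm.parallel A g, fun n N x => ?_⟩
  rw [Algorithm.terminatesWith_iff_eventually]
  have h : ∀ᶠ t in atTop, ∀ s, ∀ i, (A s).output N x t i = some (f s n x) :=
    eventually_all.2 fun s => ((A s).terminatesWith_iff_eventually N x _).1 (hA s n N x)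
  filter_upwards [h, eventually_ge_atTop 1] with t ht h1 i
  obtain ⟨t, rfl⟩ := Nat.exists_eq_add_of_le' h1
  simp only [Algorithm.parallel_output_succ, ht, combineOutputs_some]

theorem NetworkComputable.congr {K : ℕ} {Y : Type} [Finite Y]
    {f f' : ∀ n : ℕ, (Fin n → Fin (K + 1)) → Y} (hf : NetworkComputable f)
    (h : ∀ (n : ℕ) (x : Fin n → Fin (K + 1)), 0 < n → f n x = f' n x) :
    NetworkComputable f' := by
  obtain ⟨A, hA⟩ := hf
  refine ⟨A, fun n N x => ?_⟩
  rw [← h n x (Fin.pos_iff_nonempty.2 N.connected.nonempty)]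
  exact hA n N x

/-! ### Interval-averaging from threshold comparisons -/

theorem average_mem_intervalAverage {K n : ℕ} (x : Fin n → Fin (K + 1)) :
    average x ∈ (intervalAverage K n x : Set ℝ) :=
  (existsUnique_interval x).choose_spec.1

theorem intervalAverage_eq_of_mem {K n : ℕ} (x : Fin n → Fin (K + 1)) (s : intervals K)
    (h : average x ∈ (s : Set ℝ)) : s = intervalAverage K n x :=
  (existsUnique_interval x).choose_spec.2 s h

/-- The sizes may differ because the decoder below picks an arbitrary input with the observed
comparison bits. -/
theorem intervalAverage_eq {K n n' : ℕ} (x : Fin n → Fin (K + 1)) (x' : Fin n' → Fin (K + 1))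
    (h1 : ∀ k : ℕ, k ≤ K → ((k : ℝ) < average x ↔ (k : ℝ) < average x'))
    (h2 : ∀ k : ℕ, k ≤ K → (average x < k ↔ average x' < k)) :
    intervalAverage K n x = intervalAverage K n' x' := by
  refine intervalAverage_eq_of_mem x' _ ?_
  have h := average_mem_intervalAverage x
  obtain ⟨k, hk, hs⟩ | ⟨k, hk, hs⟩ := (intervalAverage K n x).2
  · rw [hs] at h ⊢
    have e : average x = k := h
    have h1' := h1 k hk
    have h2' := h2 k hk
    simp only [e, lt_irrefl, false_iff, not_lt] at h1' h2'
    exact le_antisymm h1' h2'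
  · rw [hs] at h ⊢
    have h2' := h2 (k + 1) hk
    push_cast at h2'
    exact ⟨(h1 k hk.le).1 h.1, h2'.1 h.2⟩

theorem lt_average_iff {K n : ℕ} (hn : 0 < n) (x : Fin n → Fin (K + 1)) (k : ℕ) :
    (k : ℝ) < average x ↔ 0 < ∑ i, (((x i : ℕ) : ℤ) - k) := by
  rw [average, lt_div_iff₀ (by exact_mod_cast hn)]
  simp only [Finset.sum_sub_distrib, Finset.sum_const, Finset.card_univ, Fintype.card_fin,
    nsmul_eq_mul, sub_pos]
  rw [mul_comm]
  exact_mod_cast Iff.rfl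

theorem average_lt_iff {K n : ℕ} (hn : 0 < n) (x : Fin n → Fin (K + 1)) (k : ℕ) :
    average x < k ↔ 0 < ∑ i, ((k : ℤ) - ((x i : ℕ) : ℤ)) := by
  rw [average, div_lt_iff₀ (by exact_mod_cast hn)]
  simp only [Finset.sum_sub_distrib, Finset.sum_const, Finset.card_univ, Fintype.card_fin,
    nsmul_eq_mul, sub_pos]
  rw [mul_comm]
  exact_mod_cast Iff.rfl

/-- If all signs of weighted sums are computable, then so is interval-averaging. -/
theorem intervalAverage_computable_of_sign (K : ℕ)
    (hsign : ∀ w : Fin (K + 1) → ℤ,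
      NetworkComputable fun n (x : Fin n → Fin (K + 1)) => decide (0 < ∑ i, w (x i))) :
    NetworkComputable (intervalAverage K) := by
  classical
  let w : Fin (K + 1) × Bool → Fin (K + 1) → ℤ := fun s a =>
    if s.2 then ((a : ℕ) : ℤ) - (s.1 : ℕ) else ((s.1 : ℕ) : ℤ) - (a : ℕ)
  let bits : ∀ n : ℕ, (Fin n → Fin (K + 1)) → Fin (K + 1) × Bool → Bool := fun n x s =>
    decide (0 < ∑ i, w s (x i))
  -- The bits determine the interval, so any input realizing them decodes them. The `else` value
  -- only makes `g` total.
  let g : (Fin (K + 1) × Bool → Bool) → intervals K := fun b =>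
    if h : ∃ p : Σ n : ℕ, Fin n → Fin (K + 1), 0 < p.1 ∧ bits p.1 p.2 = b
    then intervalAverage K _ h.choose.2 else intervalAverage K 0 Fin.elim0
  refine (NetworkComputable.comp_pi (fun s => hsign (w s)) g).congr fun n x hn => ?_
  have hex : ∃ p : Σ n : ℕ, Fin n → Fin (K + 1), 0 < p.1 ∧ bits p.1 p.2 = bits n x :=
    ⟨⟨n, x⟩, hn, rfl⟩
  change g (bits n x) = _
  simp only [g, dif_pos hex]
  obtain ⟨hpos, heq⟩ := hex.choose_spec
  refine intervalAverage_eq _ _ (fun k hk => ?_) fun k hk => ?_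
  · rw [lt_average_iff hpos, lt_average_iff hn]
    simpa [bits, w] using congrFun heq (⟨k, Nat.lt_succ_of_le hk⟩, true)
  · rw [average_lt_iff hpos, average_lt_iff hn]
    simpa [bits, w] using congrFun heq (⟨k, Nat.lt_succ_of_le hk⟩, false)

/-! ### Token diffusion on a connected graph -/

theorem exists_forall_ge_eq_of_le_succ {f : ℕ → ℤ} {T : ℕ} (h : ∀ t ≥ T, f t ≤ f (t + 1)) {b : ℤ}
    (hb : ∀ t, f t ≤ b) : ∃ T' ≥ T, ∀ t ≥ T', f t = f T' := by
  have hmono : Monotone fun t => f (T + t) := monotone_nat_of_le_succ fun t => h _ (by omega)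
  obtain ⟨m, ⟨t₀, rfl⟩, hm⟩ := Int.exists_greatest_of_bdd
    (P := fun z => ∃ t, z = f (T + t)) ⟨b, by rintro _ ⟨t, rfl⟩; exact hb _⟩ ⟨_, 0, rfl⟩
  refine ⟨T + t₀, by omega, fun t ht => ?_⟩
  obtain ⟨s, rfl⟩ := Nat.exists_eq_add_of_le ht
  refine le_antisymm (hm _ ⟨t₀ + s, by rw [add_assoc]⟩) ?_
  simpa only [add_assoc] using hmono (Nat.le_add_right t₀ s)

/-- Tokens (positive loads) move along a flow `E`, negative loads stay in place. If every node that
is positive infinitely often sends tokens to each of its neighbors infinitely often, then in the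
long run all loads have the same sign as the total load, and when this sign is positive, every
node has a positive load infinitely often. -/
theorem SimpleGraph.Connected.diffusion_limit {V : Type*} [Fintype V] {G : SimpleGraph V}
    (hG : G.Connected) {v : ℕ → V → ℤ} {E : ℕ → V → V → ℤ} {T : ℕ} {S : ℤ}
    (hE : ∀ t i j, 0 ≤ E t i j) (hcap : ∀ t i, ∑ j, E t i j ≤ max (v t i) 0)
    (hstep : ∀ t ≥ T, ∀ i, v (t + 1) i = v t i - ∑ j, E t i j + ∑ j, E t j i)
    (hfair : ∀ i, (∃ᶠ t in atTop, 0 < v t i) → ∀ j, G.Adj i j → ∃ᶠ t in atTop, 0 < E t i j)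
    (hS : ∀ᶠ t in atTop, ∑ i, v t i = S) :
    (0 < S ∧ (∀ᶠ t in atTop, ∀ i, 0 ≤ v t i) ∧ ∀ i, ∃ᶠ t in atTop, 0 < v t i) ∨
      (S ≤ 0 ∧ ∀ᶠ t in atTop, ∀ i, v t i ≤ 0) := by
  have hin : ∀ t i j, E t j i ≤ ∑ j, E t j i := fun t i j =>
    Finset.single_le_sum (f := fun j => E t j i) (fun j _ => hE t j i) (Finset.mem_univ j)
  have hin0 : ∀ t i, 0 ≤ ∑ j, E t j i := fun t i => Finset.sum_nonneg fun j _ => hE t j i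
  -- Only available tokens leave, so a negative node sends nothing and no other node drops below
  -- zero.
  have hmono : ∀ i, ∀ t ≥ T, min (v t i) 0 ≤ min (v (t + 1) i) 0 := fun i t ht => by
    have h1 := hcap t i
    have h2 := hstep t ht i
    have h3 := hin0 t i
    omega
  have hconst : ∀ᶠ t₀ in atTop, ∀ i, ∀ t ≥ t₀, min (v t i) 0 = min (v t₀ i) 0 := by
    refine eventually_all.2 fun i => ?_
    obtain ⟨T', -, hT'⟩ := exists_forall_ge_eq_of_le_succ (hmono i) (fun t => min_le_right _ _)
    filter_upwards [eventually_ge_atTop T'] with t₀ ht₀ t ht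
    rw [hT' t (ht₀.trans ht), hT' t₀ ht₀]
  have hnn : ∀ i, (∃ᶠ t in atTop, 0 < v t i) → ∀ᶠ t in atTop, 0 ≤ v t i := fun i hi => by
    filter_upwards [hconst] with t ht
    obtain ⟨s, hs, hpos⟩ := frequently_atTop.1 hi t
    have := ht i s hs
    omega
  by_cases hex : ∃ i, ∃ᶠ t in atTop, 0 < v t i
  · left
    obtain ⟨i₀, hi₀⟩ := hex
    -- Once negative parts are frozen, a token cannot land on a negative load, as it would raise it;
    -- on a nonnegative one it leaves a positive load.
    have hadj : ∀ i j, G.Adj i j → (∃ᶠ t in atTop, 0 < v t i) → ∃ᶠ t in atTop, 0 < v t j := by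
      intro i j hij hi
      have hf := (hfair i hi j hij).and_eventually (hconst.and (eventually_ge_atTop T))
      refine frequently_atTop.2 fun a => ?_
      obtain ⟨t, hta, hpos, hc, hT⟩ := frequently_atTop.1 hf a
      refine ⟨t + 1, by omega, ?_⟩
      have h1 := hcap t j
      have h2 := hstep t hT j
      have h3 := hin t j i
      have h4 := hc j (t + 1) (by omega)
      omega
    have hall : ∀ i, ∃ᶠ t in atTop, 0 < v t i := fun i => by
      obtain ⟨p⟩ := hG.preconnected i₀ i
      induction p with
      | nil => exact hi₀
      | cons h _ ih => exact ih (hadj _ _ h hi₀)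
    have hev : ∀ᶠ t in atTop, ∀ i, 0 ≤ v t i := eventually_all.2 fun i => hnn i (hall i)
    refine ⟨?_, hev, hall⟩
    obtain ⟨t, hpos, h1, h2⟩ := ((hall i₀).and_eventually (hS.and hev)).exists
    rw [← h1]
    exact Finset.sum_pos' (fun i _ => h2 i) ⟨i₀, Finset.mem_univ _, hpos⟩
  · right
    have hev : ∀ᶠ t in atTop, ∀ i, v t i ≤ 0 := eventually_all.2 fun i => by
      simpa [not_frequently] using not_exists.1 hex i
    refine ⟨?_, hev⟩
    obtain ⟨t, h1, h2⟩ := (hS.and hev).exists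
    rw [← h1]
    exact Finset.sum_nonpos fun i _ => h2 i

/-! ### The rotor rule -/

/-- The number of tokens in a family of messages. -/
def tokenCount {d : ℕ} (m : Fin d → Bool) : ℤ := ∑ k, if m k then 1 else 0

theorem tokenCount_nonneg {d : ℕ} (m : Fin d → Bool) : 0 ≤ tokenCount m :=
  Finset.sum_nonneg fun k _ => by split_ifs <;> simp

theorem tokenCount_le {d : ℕ} (m : Fin d → Bool) : tokenCount m ≤ d := by
  refine (Finset.sum_le_card_nsmul Finset.univ _ 1 fun k _ => ?_).trans (by simp)
  split_ifs <;> simp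

/-- A node of degree `d` with load `v` and rotor position `r` sends a token through each port if it
has at least `d` tokens, and otherwise one token through port `r` if it has any. Nothing is sent at
the position `r = d`. -/
def emit (d : ℕ) (v : ℤ) (r : Fin (d + 1)) (k : Fin d) : Bool :=
  decide ((d : ℤ) ≤ v ∨ 0 < v ∧ r = k.castSucc)

theorem tokenCount_emit_le (d : ℕ) (v : ℤ) (r : Fin (d + 1)) :
    tokenCount (emit d v r) ≤ max v 0 := by
  by_cases h : (d : ℤ) ≤ v
  · exact (tokenCount_le _).trans (h.trans (le_max_left _ _))
  · by_cases h0 : 0 < v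
    · have h1 : tokenCount (emit d v r) ≤ 1 := by
        simp only [tokenCount, emit, h, h0, false_or, true_and, decide_eq_true_eq]
        rw [Finset.sum_boole]
        norm_cast
        refine Finset.card_le_one.2 fun a ha b hb => ?_
        simp only [Finset.mem_filter, Finset.mem_univ, true_and] at ha hb
        exact Fin.castSucc_injective _ (ha.symm.trans hb)
      omega
    · simp [tokenCount, emit, h, h0]

theorem tokenCount_emit_of_le {d : ℕ} {v : ℤ} (h : (d : ℤ) ≤ v) (r : Fin (d + 1)) :
    tokenCount (emit d v r) = d := by
  simp [tokenCount, emit, h]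

open Fin.NatCast in
/-- A rotor that advances infinitely often takes each position infinitely often when about to
advance. -/
theorem rotor_frequently {d : ℕ} {p : ℕ → Prop} {r : ℕ → Fin (d + 1)}
    (hr : ∀ t, p t → r (t + 1) = r t + 1) (hr' : ∀ t, ¬ p t → r (t + 1) = r t)
    (hp : ∃ᶠ t in atTop, p t) (k : Fin (d + 1)) : ∃ᶠ t in atTop, p t ∧ r t = k := by
  classical
  -- After an advance from `k` the rotor rests at `k + 1` until the next time `p` holds.
  have hnext : ∀ k, (∃ᶠ t in atTop, p t ∧ r t = k) → ∃ᶠ t in atTop, p t ∧ r t = k + 1 := by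
    intro k hk
    refine frequently_atTop.2 fun a => ?_
    obtain ⟨t, hta, hpt, rfl⟩ := frequently_atTop.1 hk a
    have hex : ∃ s, p (t + 1 + s) := by
      obtain ⟨s, hs, hps⟩ := frequently_atTop.1 hp (t + 1)
      obtain ⟨s, rfl⟩ := Nat.exists_eq_add_of_le hs
      exact ⟨s, hps⟩
    have hconst : ∀ s ≤ Nat.find hex, r (t + 1 + s) = r t + 1 := by
      intro s
      induction s with
      | zero => exact fun _ => hr t hpt
      | succ s ih =>
        intro hs
        rw [← ih (by omega), ← hr' _ (Nat.find_min hex (m := s) (by omega))]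
        rfl
    exact ⟨_, by omega, Nat.find_spec hex, hconst _ le_rfl⟩
  -- Pigeonhole over the finitely many positions; the others follow by cyclic shifts.
  obtain ⟨k₀, hk₀⟩ : ∃ k₀, ∃ᶠ t in atTop, p t ∧ r t = k₀ := by
    by_contra hno
    simp only [not_exists, not_frequently] at hno
    obtain ⟨t, hpt, ht⟩ := (hp.and_eventually (eventually_all.2 hno)).exists
    exact ht (r t) ⟨hpt, rfl⟩
  have hshift : ∀ m : ℕ, ∃ᶠ t in atTop, p t ∧ r t = k₀ + (m : Fin (d + 1)) := by
    intro m
    induction m with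
    | zero => simpa using hk₀
    | succ m ih =>
      have h := hnext _ ih
      rwa [add_assoc, ← Nat.cast_succ] at h
  have h := hshift (k - k₀ : Fin (d + 1)).val
  rwa [Fin.cast_val_eq_self, add_sub_cancel] at h

/-! ### Messages on a network -/

namespace Network

variable {n : ℕ} (N : Network n)

/-- The messages that reach node `i` when the nodes have put `m` into their ports. -/
noncomputable def incoming {M : Type} (m : ∀ i, Fin (N.deg i) → M) (i : Fin n)
    (k : Fin (N.deg i)) : M :=
  m ((N.port i).symm k) (N.port ((N.port i).symm k) ⟨i, ((N.port i).symm k).2.symm⟩)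

/-- The number of tokens sent from `i` to `j`. -/
noncomputable def flow (m : ∀ i, Fin (N.deg i) → Bool) (i j : Fin n) : ℤ :=
  open Classical in
  if h : N.G.Adj i j then (if m i (N.port i ⟨j, h⟩) then 1 else 0) else 0

theorem flow_nonneg (m : ∀ i, Fin (N.deg i) → Bool) (i j : Fin n) : 0 ≤ N.flow m i j := by
  unfold flow
  split_ifs <;> simp

theorem sum_neighborSet (i : Fin n) (f : Fin n → ℤ) (hf : ∀ j, ¬ N.G.Adj i j → f j = 0) :
    ∑ k, f ((N.port i).symm k) = ∑ j, f j := by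
  classical
  rw [Equiv.sum_comp (N.port i).symm fun j : N.G.neighborSet i => f j]
  rw [← Finset.sum_subset (Finset.subset_univ (N.G.neighborFinset i)) fun j _ hj =>
    hf j (by simpa using hj)]
  exact (Finset.sum_subtype _ (fun j => by simp) f).symm

theorem tokenCount_eq_sum_flow (m : ∀ i, Fin (N.deg i) → Bool) (i : Fin n) :
    tokenCount (m i) = ∑ j, N.flow m i j := by
  rw [← N.sum_neighborSet i (N.flow m i) fun j hj => by simp [flow, hj]]
  refine Finset.sum_congr rfl fun k _ => ?_
  have h : N.G.Adj i ((N.port i).symm k) := ((N.port i).symm k).2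
  have e : (⟨((N.port i).symm k : Fin n), h⟩ : N.G.neighborSet i) = (N.port i).symm k := rfl
  simp only [flow, dif_pos h, e, Equiv.apply_symm_apply]

theorem tokenCount_incoming_eq_sum_flow (m : ∀ i, Fin (N.deg i) → Bool) (i : Fin n) :
    tokenCount (N.incoming m i) = ∑ j, N.flow m j i := by
  rw [← N.sum_neighborSet i (fun j => N.flow m j i) fun j hj => by
    simp [flow, N.G.adj_comm j i, hj]]
  refine Finset.sum_congr rfl fun k _ => ?_
  have h : N.G.Adj ((N.port i).symm k) i := ((N.port i).symm k).2.symm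
  simp only [flow, incoming, dif_pos h]
  rfl

/-- Each token put into a port reaches exactly one node: both sides sum the flow over all pairs. -/
theorem sum_tokenCount_incoming (m : ∀ i, Fin (N.deg i) → Bool) :
    ∑ i, tokenCount (N.incoming m i) = ∑ i, tokenCount (m i) := by
  simp only [tokenCount_incoming_eq_sum_flow]
  simp only [tokenCount_eq_sum_flow]
  exact Finset.sum_comm

end Network

/-! ### Load tracking -/

/-- A run of the load tracking process: node `i` has input `a t i`, net inflow `u t i`, rotor
position `r t i`, and tokens `m t i` in its ports. Its load is its net inflow plus the tokens that
arrive plus its input. -/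
structure LoadRun {n : ℕ} (N : Network n) (a u : ℕ → Fin n → ℤ)
    (r : ∀ (_ : ℕ) (i : Fin n), Fin (N.deg i + 1))
    (m : ∀ (_ : ℕ) (i : Fin n), Fin (N.deg i) → Bool) (v : ℕ → Fin n → ℤ) : Prop where
  load : ∀ t i, v t i = u t i + tokenCount (N.incoming (m t) i) + a t i
  u_zero : ∀ i, u 0 i = 0
  m_zero : ∀ i k, m 0 i k = false
  m_succ : ∀ t i, m (t + 1) i = emit (N.deg i) (v t i) (r t i)
  u_succ : ∀ t i, u (t + 1) i =
    u t i + tokenCount (N.incoming (m t) i) - tokenCount (m (t + 1) i)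
  r_succ : ∀ t i, r (t + 1) i = if 0 < v t i then r t i + 1 else r t i

namespace LoadRun

variable {n : ℕ} {N : Network n} {a u : ℕ → Fin n → ℤ}
  {r : ∀ (_ : ℕ) (i : Fin n), Fin (N.deg i + 1)}
  {m : ∀ (_ : ℕ) (i : Fin n), Fin (N.deg i) → Bool} {v : ℕ → Fin n → ℤ}
  (h : LoadRun N a u r m v)
include h

/-- Net inflows and tokens in transit cancel in total, whatever the inputs do. This is why the net
inflow, rather than the load, is the stored quantity. -/
theorem sum_load (t : ℕ) : ∑ i, v t i = ∑ i, a t i := by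
  have key : ∑ i, (u t i + tokenCount (N.incoming (m t) i)) = 0 := by
    rw [Finset.sum_add_distrib, N.sum_tokenCount_incoming, ← Finset.sum_add_distrib]
    induction t with
    | zero => simp [h.u_zero, h.m_zero, tokenCount]
    | succ t ih =>
      rw [Finset.sum_add_distrib, ← N.sum_tokenCount_incoming, ← Finset.sum_add_distrib] at ih
      simpa [h.u_succ] using ih
  simp only [h.load, Finset.sum_add_distrib] at key ⊢
  rw [key, zero_add]

theorem load_succ (t : ℕ) (i : Fin n) : v (t + 1) i = v t i - tokenCount (m (t + 1) i) +
    tokenCount (N.incoming (m (t + 1)) i) + (a (t + 1) i - a t i) := by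
  rw [h.load, h.load, h.u_succ]
  ring

theorem tokenCount_succ_le (t : ℕ) (i : Fin n) : tokenCount (m (t + 1) i) ≤ max (v t i) 0 := by
  rw [h.m_succ]
  exact tokenCount_emit_le _ _ _

theorem limit {a' : Fin n → ℤ} (ha : ∀ᶠ t in atTop, ∀ i, a t i = a' i) :
    (0 < ∑ i, a' i ∧ (∀ᶠ t in atTop, ∀ i, 0 ≤ v t i) ∧ ∀ i, ∃ᶠ t in atTop, 0 < v t i) ∨
      (∑ i, a' i ≤ 0 ∧ ∀ᶠ t in atTop, ∀ i, v t i ≤ 0) := by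
  obtain ⟨T, hT⟩ := eventually_atTop.1 ha
  -- The tokens emitted at step `t` are `m (t + 1)`.
  refine N.connected.diffusion_limit (E := fun t => N.flow (m (t + 1))) (T := T)
    (fun t => N.flow_nonneg _) (fun t i => ?_) (fun t ht i => ?_) (fun i hi j hij => ?_) ?_
  · rw [← N.tokenCount_eq_sum_flow]
    exact h.tokenCount_succ_le t i
  · rw [← N.tokenCount_eq_sum_flow, ← N.tokenCount_incoming_eq_sum_flow, h.load_succ,
      hT t ht, hT (t + 1) (by omega)]
    ring
  -- The rotor advances exactly when the load is positive, so it points to the port towards `j`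
  -- infinitely often with a token to send.
  · refine (rotor_frequently (p := fun t => 0 < v t i) (r := fun t => r t i)
      (fun t ht => by rw [h.r_succ, if_pos ht]) (fun t ht => by rw [h.r_succ, if_neg ht]) hi
      (N.port i ⟨j, hij⟩).castSucc).mono fun t ht => ?_
    simp [Network.flow, hij, h.m_succ, emit, ht.1, ht.2]
  · filter_upwards [ha] with t ht
    rw [h.sum_load]
    exact Finset.sum_congr rfl fun i _ => ht i

/-- A flag that is cleared by a positive load and raised by tokens arriving without making the load
positive stabilizes, and some flag stays raised exactly if the total input is not positive. -/
theorem flag_limit {a' : Fin n → ℤ} (ha : ∀ t i, a t i = a' i) {b : ℕ → Fin n → Bool}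
    (hb0 : ∀ i, b 0 i = true)
    (hb : ∀ t i, b (t + 1) i = if 0 < v t i then false
      else if 0 < tokenCount (N.incoming (m t) i) then true else b t i) :
    ∃ b' : Fin n → Bool, (∀ᶠ t in atTop, ∀ i, b t i = b' i) ∧
      (∑ i, a' i ≤ 0 ↔ ∃ i, b' i = true) := by
  obtain ⟨h0, hnn, hpos⟩ | ⟨h0, hnp⟩ := h.limit (.of_forall fun t i => ha t i)
  · refine ⟨fun _ => false, eventually_all.2 fun i => ?_, by simpa using h0⟩
    obtain ⟨T, hT⟩ := eventually_atTop.1 hnn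
    obtain ⟨t, ht, hpt⟩ := frequently_atTop.1 (hpos i) (T + 1)
    filter_upwards [eventually_gt_atTop t] with s hs
    induction s, hs using Nat.le_induction with
    | base => rw [hb, if_pos hpt]
    | succ s hs ih =>
      rw [hb, ih]
      split_ifs with h1 h2
      · rfl
      -- A token arriving after a nonnegative load makes the new load positive, so the flag cannot
      -- be raised again.
      · obtain ⟨s, rfl⟩ := Nat.exists_eq_add_of_le' (show 1 ≤ s by omega)
        have h3 := h.load_succ s i
        have h4 := h.tokenCount_succ_le s i
        have h5 := hT s (by omega) i
        rw [ha, ha] at h3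
        omega
      · rfl
  -- Invariant: a positive load either emits a token or stays positive; at a nonpositive load an
  -- arriving token raises the flag, and a raised flag persists. When loads and tokens die out, only
  -- a flag can remain.
  · have hinv : ∀ t, ∃ i, b t i = true ∨ 0 < v t i ∨ 0 < tokenCount (N.incoming (m t) i) := by
      intro t
      induction t with
      | zero =>
        obtain ⟨i⟩ := N.connected.nonempty
        exact ⟨i, .inl (hb0 i)⟩
      | succ t ih =>
        obtain ⟨i, hi⟩ := ih
        by_cases hv : 0 < v t i
        · by_cases hm : 0 < tokenCount (m (t + 1) i)
          · have hsum : 0 < ∑ i, tokenCount (N.incoming (m (t + 1)) i) := by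
              rw [N.sum_tokenCount_incoming]
              exact Finset.sum_pos' (fun i _ => tokenCount_nonneg _) ⟨i, Finset.mem_univ _, hm⟩
            obtain ⟨j, -, hj⟩ := Finset.exists_lt_of_sum_lt
              (f := fun _ => (0 : ℤ)) (by simpa using hsum)
            exact ⟨j, .inr (.inr hj)⟩
          · refine ⟨i, .inr (.inl ?_)⟩
            have h3 := h.load_succ t i
            have h4 := tokenCount_nonneg (N.incoming (m (t + 1)) i)
            rw [ha, ha] at h3
            omega
        · refine ⟨i, .inl ?_⟩
          rw [hb, if_neg hv]
          split_ifs with h2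
          · rfl
          · tauto
    obtain ⟨T, hT⟩ := eventually_atTop.1 hnp
    -- Tokens present at time `t` were emitted from the loads at time `t - 1`, hence the shift by
    -- one.
    have hm : ∀ t ≥ T + 1, ∀ i, tokenCount (N.incoming (m t) i) = 0 := by
      intro t ht i
      obtain ⟨t, rfl⟩ := Nat.exists_eq_add_of_le' (show 1 ≤ t by omega)
      have hle : ∑ i, tokenCount (N.incoming (m (t + 1)) i) ≤ 0 := by
        rw [N.sum_tokenCount_incoming]
        refine Finset.sum_nonpos fun i _ => (h.tokenCount_succ_le t i).trans ?_
        simp [hT t (by omega) i]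
      exact (Finset.sum_eq_zero_iff_of_nonneg fun i _ => tokenCount_nonneg _).1
        (le_antisymm hle (Finset.sum_nonneg fun i _ => tokenCount_nonneg _)) i (Finset.mem_univ i)
    refine ⟨b (T + 1), ?_, iff_of_true h0 ?_⟩
    · filter_upwards [eventually_ge_atTop (T + 1)] with t ht
      induction t, ht using Nat.le_induction with
      | base => exact fun _ => rfl
      | succ t ht ih =>
        intro i
        rw [hb, if_neg (hT t (by omega) i).not_gt, hm t ht, if_neg (lt_irrefl _), ih]
    · obtain ⟨i, hi⟩ := hinv (T + 1)
      have h1 := hT (T + 1) (by omega) i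
      have h2 := hm (T + 1) le_rfl i
      exact ⟨i, hi.resolve_right (by omega)⟩

end LoadRun

/-! ### The sign detection algorithm -/

/-- The memory of the load tracking process with inputs bounded by `C`, at a node of degree `d`: the
net inflow and the rotor position. -/
abbrev LoadState (C d : ℕ) : Type := Set.Icc (-C : ℤ) (d + C) × Fin (d + 1)

namespace LoadState

variable {C d : ℕ}

/-- Lower bound: sending cannot take the load below `min v 0`. Upper bound: if the load is at least
`d`, the `d` tokens sent offset the at most `d` received; otherwise `u + q < d - a`. -/
theorem netInflow_mem {u a q : ℤ} (hu : u ∈ Set.Icc (-C : ℤ) (d + C)) (ha : |a| ≤ C)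
    (hq0 : 0 ≤ q) (hq : q ≤ d) (r : Fin (d + 1)) :
    u + q - tokenCount (emit d (u + q + a) r) ∈ Set.Icc (-C : ℤ) (d + C) := by
  have h1 := tokenCount_emit_le d (u + q + a) r
  have h2 := tokenCount_nonneg (emit d (u + q + a) r)
  obtain ⟨h3, h4⟩ := hu
  obtain ⟨h5, h6⟩ := abs_le.1 ha
  refine ⟨by omega, ?_⟩
  by_cases h : (d : ℤ) ≤ u + q + a
  · rw [tokenCount_emit_of_le h]
    omega
  · omega

/-- The load, after receiving the tokens `m`. -/
def load (z : LoadState C d) (a : ℤ) (m : Fin d → Bool) : ℤ := z.1 + tokenCount m + a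

/-- The next state, when the input is `a` and the tokens `m` are received. -/
def next (z : LoadState C d) (a : ℤ) (ha : |a| ≤ C) (m : Fin d → Bool) : LoadState C d :=
  (⟨_, netInflow_mem z.1.2 ha (tokenCount_nonneg m) (tokenCount_le m) z.2⟩,
    if 0 < z.load a m then z.2 + 1 else z.2)

/-- The tokens sent. -/
def send (z : LoadState C d) (a : ℤ) (m : Fin d → Bool) : Fin d → Bool :=
  emit d (z.load a m) z.2

end LoadState

/-- A bound for the values of `w` that is at least one. -/
def weightBound {K : ℕ} (w : Fin (K + 1) → ℤ) : ℕ := 1 + ∑ x, (w x).natAbs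

theorem abs_le_weightBound {K : ℕ} (w : Fin (K + 1) → ℤ) (x : Fin (K + 1)) : |w x| ≤ weightBound w := by
  have h := Finset.single_le_sum (f := fun x => (w x).natAbs) (fun _ _ => Nat.zero_le _)
    (Finset.mem_univ x)
  rw [Int.abs_eq_natAbs]
  unfold weightBound
  omega

theorem abs_toInt_le_weightBound {K : ℕ} (w : Fin (K + 1) → ℤ) (b : Bool) :
    |(b.toNat : ℤ)| ≤ weightBound w := by
  unfold weightBound
  cases b <;> simp <;> positivity

/-- The algorithm that detects whether the sum of the weights `w (x i)` is positive. A first load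
tracking process diffuses the weights; a second one diffuses flags, some of which survive
exactly if no positive loads do. A node outputs which process has reached it last. -/
noncomputable def signAlgorithm {K : ℕ} (w : Fin (K + 1) → ℤ) : Algorithm K Bool where
  M := Bool × Bool
  finite_M := inferInstance
  m₀ := (false, false)
  Z := fun d => LoadState (weightBound w) d × LoadState (weightBound w) d × Bool
  finite_Z := fun d => inferInstance
  z₀ := fun d =>
    let z : LoadState (weightBound w) d := (⟨0, by constructor <;> omega⟩, 0)
    (z, z, true)
  trans := fun d x z y m =>
    let m₁ := fun k => (m k).1
    let m₂ := fun k => (m k).2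
    let v₁ := z.1.load (w x) m₁
    let v₂ := z.2.1.load z.2.2.toNat m₂
    ((z.1.next (w x) (abs_le_weightBound w x) m₁,
      z.2.1.next z.2.2.toNat (abs_toInt_le_weightBound w z.2.2) m₂,
      if 0 < v₁ then false else if 0 < tokenCount m₁ then true else z.2.2),
     if 0 < v₁ then some true else if 0 < v₂ then some false else y,
     fun k => (z.1.send (w x) m₁ k, z.2.1.send z.2.2.toNat m₂ k))

namespace signAlgorithm

variable {K : ℕ} (w : Fin (K + 1) → ℤ) {n : ℕ} (N : Network n) (x : Fin n → Fin (K + 1))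

/-- The raised flags. -/
noncomputable def flag (t : ℕ) (i : Fin n) : Bool := ((signAlgorithm w).state N x t i).1.2.2

/-- The tokens of the first process. -/
noncomputable def tokens₁ (t : ℕ) (i : Fin n) (k : Fin (N.deg i)) : Bool :=
  (((signAlgorithm w).state N x t i).2.2 k).1

/-- The tokens of the second process. -/
noncomputable def tokens₂ (t : ℕ) (i : Fin n) (k : Fin (N.deg i)) : Bool :=
  (((signAlgorithm w).state N x t i).2.2 k).2

/-- The loads of the first process. -/
noncomputable def load₁ (t : ℕ) (i : Fin n) : ℤ :=
  LoadState.load ((signAlgorithm w).state N x t i).1.1 (w (x i))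
    (N.incoming (tokens₁ w N x t) i)

/-- The loads of the second process. -/
noncomputable def load₂ (t : ℕ) (i : Fin n) : ℤ :=
  LoadState.load ((signAlgorithm w).state N x t i).1.2.1 (flag w N x t i).toNat
    (N.incoming (tokens₂ w N x t) i)

theorem loadRun₁ : LoadRun N (fun _ i => w (x i))
    (fun t i => ((signAlgorithm w).state N x t i).1.1.1)
    (fun t i => ((signAlgorithm w).state N x t i).1.1.2) (tokens₁ w N x) (load₁ w N x) where
  load _ _ := rfl
  u_zero _ := rfl
  m_zero _ _ := rfl
  m_succ _ _ := rfl
  u_succ _ _ := rfl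
  r_succ _ _ := rfl

theorem loadRun₂ : LoadRun N (fun t i => (flag w N x t i).toNat)
    (fun t i => ((signAlgorithm w).state N x t i).1.2.1.1)
    (fun t i => ((signAlgorithm w).state N x t i).1.2.1.2) (tokens₂ w N x) (load₂ w N x) where
  load _ _ := rfl
  u_zero _ := rfl
  m_zero _ _ := rfl
  m_succ _ _ := rfl
  u_succ _ _ := rfl
  r_succ _ _ := rfl

theorem flag_succ (t : ℕ) (i : Fin n) : flag w N x (t + 1) i =
    if 0 < load₁ w N x t i then false
    else if 0 < tokenCount (N.incoming (tokens₁ w N x t) i) then true else flag w N x t i :=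
  rfl

theorem output_succ (t : ℕ) (i : Fin n) : (signAlgorithm w).output N x (t + 1) i =
    if 0 < load₁ w N x t i then some true
    else if 0 < load₂ w N x t i then some false else (signAlgorithm w).output N x t i :=
  rfl

end signAlgorithm

/-- Once both rules are in force, a single occurrence of `p` sets the value `c`, and nothing changes
it afterwards. -/
theorem eventually_eq_of_frequently_set {Y : Type*} {y : ℕ → Y} {c : Y} {p : ℕ → Prop}
    (hp : ∃ᶠ t in atTop, p t) (hset : ∀ᶠ t in atTop, p t → y (t + 1) = c)
    (hkeep : ∀ᶠ t in atTop, ¬ p t → y (t + 1) = y t) : ∀ᶠ t in atTop, y t = c := by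
  obtain ⟨T, hT⟩ := eventually_atTop.1 (hset.and hkeep)
  obtain ⟨t, ht, hpt⟩ := frequently_atTop.1 hp T
  filter_upwards [eventually_gt_atTop t] with s hs
  induction s, hs using Nat.le_induction with
  | base => exact (hT t ht).1 hpt
  | succ s hs ih =>
    by_cases hps : p s
    · exact (hT s (by omega)).1 hps
    · rw [(hT s (by omega)).2 hps, ih]

open signAlgorithm in
-- Exactly one process has a positive limiting total. It is positive at every node infinitely often,
-- while the other eventually never is, so the output locks onto its verdict.
theorem sign_computable {K : ℕ} (w : Fin (K + 1) → ℤ) :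
    NetworkComputable fun n (x : Fin n → Fin (K + 1)) => decide (0 < ∑ i, w (x i)) := by
  refine ⟨signAlgorithm w, fun n N x => ?_⟩
  rw [Algorithm.terminatesWith_iff_eventually, eventually_all]
  intro i
  beta_reduce
  obtain ⟨b, hb, hflag⟩ := (loadRun₁ w N x).flag_limit (a' := fun i => w (x i))
    (fun _ _ => rfl) (fun _ => rfl) (flag_succ w N x)
  have hlim₁ := (loadRun₁ w N x).limit (a' := fun i => w (x i)) (.of_forall fun _ _ => rfl)
  have hlim₂ := (loadRun₂ w N x).limit (a' := fun i => (b i).toNat)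
    (hb.mono fun t ht i => by rw [ht i])
  have hsum : (0 : ℤ) < ∑ i, ((b i).toNat : ℤ) ↔ ∃ i, b i = true := by
    rw [Finset.sum_pos_iff_of_nonneg fun i _ => by positivity]
    refine ⟨fun ⟨i, _, hi⟩ => ⟨i, ?_⟩, fun ⟨i, hi⟩ => ⟨i, Finset.mem_univ i, by simp [hi]⟩⟩
    cases h : b i <;> simp_all
  rw [← hsum] at hflag
  obtain ⟨h0, -, hpos⟩ | ⟨h0, hnp⟩ := hlim₁
  · obtain ⟨h1, -⟩ | ⟨-, hnp₂⟩ := hlim₂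
    -- Both totals cannot be positive: a surviving flag certifies a nonpositive first total.
    · exact absurd (hflag.2 h1) h0.not_ge
    refine eventually_eq_of_frequently_set (hpos i) (.of_forall fun t ht => ?_) ?_
    · rw [output_succ, if_pos ht, decide_eq_true h0]
    · filter_upwards [hnp₂] with t ht hv
      rw [output_succ, if_neg hv, if_neg (ht i).not_gt]
  · obtain ⟨-, -, hpos₂⟩ | ⟨h1, -⟩ := hlim₂
    · refine eventually_eq_of_frequently_set (hpos₂ i) ?_ ?_
      · filter_upwards [hnp] with t ht hv
        rw [output_succ, if_neg (ht i).not_gt, if_pos hv, decide_eq_false h0.not_gt]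
      · filter_upwards [hnp] with t ht hv
        rw [output_succ, if_neg (ht i).not_gt, if_neg hv]
    · exact absurd (hflag.1 h0) h1.not_gt

theorem mainTheorem2 (K : ℕ) : NetworkComputable (intervalAverage K) := by
  exact intervalAverage_computable_of_sign K sign_computable
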